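/- Let $(\Omega,\mathcal F,(\mathcal F_t)_{t\ge0},P)$ be a filtered probability space carrying a $d$-dimensional $(\mathcal F_t)$-Brownian motion $W$, $d\ge 1$, and consider the linear McKean–Vlasov equation $$dX_t=\Big(\int_{\mathbb R^d}y\,\mathcal L_{X_t}(dy)\Big)dt+\sqrt2\,dW_t=E[X_t]\,dt+\sqrt2\,dW_t ,\qquad X_0=\xi ,$$ where $\mathcal L_{X_t}$ is the law of $X_t$. A solution is an adapted process with a.s. continuous paths such that every $X_t$ is integrable, $t\mapsto E[X_t]$ is locally integrable on $[0,\infty)$, $X_0=\xi$ a.s., and a.s. the integrated equation holds for all $t\ge0$. 1. For every integrable $\mathcal F_0$-measurable $\xi$ a solution exists, and any two solutions are indistinguishable. 2. Let $X_0$ and $X_{k,0}$, $k=1,2,\dots$, be integrable $\mathcal F_0$-measurable $\mathbb R^d$-valued random variables such that, for each $k$, $X_{k,0}\ge X_0$ a.s. (coordinatewise) and $P(X_{k,0}\neq X_0)>0$ (in particular this covers the case $X_{k,0}\ne X_0$ a.s.), and such that $X_{k,0}\to X_0$ in probability, but, for each $p\in(0,\infty)$, $X_{k,0}$ does not converge to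 $X_0$ in $L^p$. Let $X$ and $X_k$ be the solutions with initial values $X_0$ and $X_{k,0}$. Then $X_k$ does not converge to $X$ in probability: for every $t>0$, $X_{k,t}$ does not converge to $X_t$ in probability, and for every $T>0$, $\sup_{0\le t\le T}|X_{k,t}-X_t|$ does not converge to $0$ in probability. 3. Such initial values exist, and can be chosen square integrable and with $X_{k,0}\neq X_0$ a.s. for every $k$, whenever $\mathcal F_0$ contains events of arbitrarily small positive probability. -/

import Mathlib

open MeasureTheory ProbabilityTheory Filter Topology
open scoped NNReal ENNReal

namespace MVSDE

/-- `W` is a `d`-dimensional Brownian motion on the filtered probability space `(Ω, 𝓕, P)`: it is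
adapted, its coordinates are independent real Brownian motions (started at `0`, with almost surely
continuous paths), and `W t - W s` is independent of `𝓕 s` for `s ≤ t`. -/
structure IsFilteredBrownian {Ω : Type*} {mΩ : MeasurableSpace Ω} {d : ℕ}
    (W : ℝ≥0 → Ω → EuclideanSpace ℝ (Fin d)) (𝓕 : Filtration ℝ≥0 mΩ) (P : Measure Ω) : Prop where
  adapted : StronglyAdapted 𝓕 W
  brownian_coord : ∀ i, IsBrownianReal (fun t ω ↦ W t ω i) P
  indep_coord : iIndepFun (fun (i : Fin d) (ω : Ω) (t : ℝ≥0) ↦ W t ω i) P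
  indep_increment : ∀ s t : ℝ≥0, s ≤ t →
    Indep (MeasurableSpace.comap (fun ω ↦ W t ω - W s ω) inferInstance) (𝓕 s) P

/-- The drift coefficient `μ ↦ ∫ y μ(dy)`. -/
noncomputable def meanDrift {d : ℕ} (μ : Measure (EuclideanSpace ℝ (Fin d))) :
    EuclideanSpace ℝ (Fin d) :=
  ∫ y, y ∂μ

/-- `X` is a (strong) solution on `[0, ∞)` of `dX_t = (∫ y L_{X_t}(dy)) dt + √2 dW_t`, `X_0 = ξ`.
The law of `X_t` is `P.map (X t)`; it has a finite first moment, so that the drift is a genuine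
integral. The stochastic integral of the constant `√2` over `[0, t]` is `√2 (W_t - W_0)`. -/
structure IsSolution {Ω : Type*} {mΩ : MeasurableSpace Ω} {d : ℕ}
    (P : Measure Ω) (𝓕 : Filtration ℝ≥0 mΩ) (W : ℝ≥0 → Ω → EuclideanSpace ℝ (Fin d))
    (ξ : Ω → EuclideanSpace ℝ (Fin d)) (X : ℝ≥0 → Ω → EuclideanSpace ℝ (Fin d)) : Prop where
  adapted : StronglyAdapted 𝓕 X
  continuous_paths : ∀ᵐ ω ∂P, Continuous (fun t ↦ X t ω)
  integrable : ∀ t, Integrable (X t) P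
  integrable_drift : ∀ t : ℝ≥0,
    IntervalIntegrable (fun s : ℝ ↦ meanDrift (P.map (X s.toNNReal))) volume 0 t
  initial : X 0 =ᵐ[P] ξ
  equation : ∀ᵐ ω ∂P, ∀ t : ℝ≥0,
    X t ω = X 0 ω + (∫ s in (0 : ℝ)..t, meanDrift (P.map (X s.toNNReal)))
      + √2 • (W t ω - W 0 ω)

/-- The processes `Y k` converge to `X` in probability, uniformly on the time interval `[0, T]`. -/
def TendstoInProbUniformly {Ω : Type*} {mΩ : MeasurableSpace Ω} {d : ℕ} (P : Measure Ω)
    (T : ℝ≥0) (Y : ℕ → ℝ≥0 → Ω → EuclideanSpace ℝ (Fin d))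
    (X : ℝ≥0 → Ω → EuclideanSpace ℝ (Fin d)) : Prop :=
  ∀ ε : ℝ≥0∞, 0 < ε →
    Tendsto (fun k ↦ P {ω | ε ≤ ⨆ t ∈ Set.Icc 0 T, edist (Y k t ω) (X t ω)}) atTop (𝓝 0)

/-- The assumptions on the initial values: `𝓕 0`-measurable and integrable, `ξ k ≥ ξ₀` (almost
surely, coordinatewise), `ξ k` is not almost surely equal to `ξ₀`, and `ξ k → ξ₀` in probability
but not in `L^p`, for any `p ∈ (0, ∞)`. The requirement `ne` is weaker than
`∀ᵐ ω ∂P, ξ k ω ≠ ξ₀ ω`. -/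
structure IsInitialData {Ω : Type*} {mΩ : MeasurableSpace Ω} {d : ℕ}
    (P : Measure Ω) (𝓕 : Filtration ℝ≥0 mΩ)
    (ξ₀ : Ω → EuclideanSpace ℝ (Fin d)) (ξ : ℕ → Ω → EuclideanSpace ℝ (Fin d)) : Prop where
  measurable_zero : StronglyMeasurable[𝓕 0] ξ₀
  measurable : ∀ k, StronglyMeasurable[𝓕 0] (ξ k)
  integrable_zero : Integrable ξ₀ P
  integrable : ∀ k, Integrable (ξ k) P
  le : ∀ k, ∀ᵐ ω ∂P, ∀ i, ξ₀ ω i ≤ ξ k ω i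
  ne : ∀ k, ¬ (ξ k =ᵐ[P] ξ₀)
  tendsto_prob : TendstoInMeasure P ξ atTop ξ₀
  not_tendsto_Lp : ∀ p : ℝ≥0, 0 < p →
    ¬ Tendsto (fun k ↦ eLpNorm (ξ k - ξ₀) (p : ℝ≥0∞) P) atTop (𝓝 0)

end MVSDE

/-! The noise is centred, so taking expectations in the equation gives m(t) = E[ξ] + ∫₀ᵗ m for the
mean m, hence m(t) = eᵗ E[ξ]. Every solution is therefore ξ + (eᵗ - 1) E[ξ] + √2 (W_t - W_0), and
this formula does define a solution (`isSolution_explicit`, `IsSolution.ae_eq_explicit`).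

In the difference of two solutions the noise cancels: it equals ξ_k - ξ₀ + (eᵗ - 1)(E[ξ_k] - E[ξ₀]).
The first term tends to 0 in probability, so convergence at a single t > 0 would force the means to
converge (`tendsto_zero_of_tendstoInMeasure_add_const`). For ordered data this is L¹ convergence
(`tendsto_eLpNorm_one_of_le`), which contradicts the assumption at p = 1.

Examples come from ever higher spikes on ever rarer events of `𝓕 0`. -/

namespace MVSDE

/-! ### The linear integral equation for the mean -/

section ODE

variable {E : Type*} [NormedAddCommGroup E] [NormedSpace ℝ E] [CompleteSpace E]

/-- A locally integrable function on `[0, ∞)` with `m t = c + ∫ s in 0..t, m s` is `exp t • c`. -/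
theorem eq_exp_smul_of_eq_add_integral {m : ℝ → E} {c : E}
    (hint : ∀ t, 0 ≤ t → IntervalIntegrable m volume 0 t)
    (h : ∀ t, 0 ≤ t → m t = c + ∫ s in (0 : ℝ)..t, m s) {t : ℝ} (ht : 0 ≤ t) :
    m t = Real.exp t • c := by
  rcases ht.eq_or_lt with rfl | ht0
  · simpa using h 0 le_rfl
  -- Bootstrapping: a primitive of an integrable function is continuous, and then m, as a primitive
  -- of a continuous function, is differentiable from the right.
  have hm : ContinuousOn m (Set.Icc 0 t) := by
    have h1 : ContinuousOn (fun x ↦ c + ∫ s in (0 : ℝ)..x, m s) (Set.Icc 0 t) := by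
      have := intervalIntegral.continuousOn_primitive_interval
        ((intervalIntegrable_iff' (μ := volume)).1 (hint t ht))
      rw [Set.uIcc_of_le ht] at this
      exact continuousOn_const.add this
    exact h1.congr fun x hx ↦ h x hx.1
  have hderiv : ∀ x ∈ Set.Ico 0 t, HasDerivWithinAt m (m x) (Set.Ici x) x := by
    intro x hx
    have hmeas : StronglyMeasurableAtFilter m (𝓝[>] x) volume :=
      ⟨Set.Ioc x t, Ioc_mem_nhdsGT hx.2,
        ((hint t ht).1.mono_set (Set.Ioc_subset_Ioc_left hx.1)).aestronglyMeasurable⟩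
    have hcont : ContinuousWithinAt m (Set.Ioi x) x :=
      ((hm x ⟨hx.1, hx.2.le⟩).mono_of_mem_nhdsWithin
        (mem_of_superset (Icc_mem_nhdsGE_of_mem ⟨le_rfl, hx.2⟩)
          (Set.Icc_subset_Icc_left hx.1))).mono Set.Ioi_subset_Ici_self
    have := (intervalIntegral.integral_hasDerivWithinAt_right (s := Set.Ici x) (t := Set.Ioi x)
      (hint x hx.1) hmeas hcont).const_add c
    exact this.congr (fun y hy ↦ h y (hx.1.trans hy)) (h x hx.1)
  -- Integrating factor: e⁻ˣ m(x) has zero right derivative.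
  have hconst := constant_of_has_deriv_right_zero (f := fun x ↦ Real.exp (-x) • m x)
    (a := 0) (b := t) ((by fun_prop : Continuous fun x : ℝ ↦ Real.exp (-x)).continuousOn.smul hm)
    (fun x hx ↦ by
      have h1 : HasDerivAt (fun x : ℝ ↦ Real.exp (-x)) (-Real.exp (-x)) x := by
        simpa using (hasDerivAt_neg x).exp
      have := h1.hasDerivWithinAt (s := Set.Ici x) |>.smul (hderiv x hx)
      rw [neg_smul, add_neg_cancel] at this
      exact this) t ⟨ht, le_rfl⟩
  have h0 : m 0 = c := by simpa using h 0 le_rfl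
  simp only [neg_zero, Real.exp_zero, one_smul, h0] at hconst
  rw [← hconst, smul_smul, ← Real.exp_add]
  simp

theorem integral_exp_smul (c : E) (t : ℝ) :
    ∫ s in (0 : ℝ)..t, Real.exp s • c = (Real.exp t - 1) • c := by
  rw [intervalIntegral.integral_smul_const, integral_exp, Real.exp_zero]

end ODE

variable {Ω : Type*} {mΩ : MeasurableSpace Ω} {P : Measure Ω} {𝓕 : Filtration ℝ≥0 mΩ} {d : ℕ}
  {W : ℝ≥0 → Ω → EuclideanSpace ℝ (Fin d)}

/-! ### Moments and paths of the noise -/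

namespace IsFilteredBrownian

theorem integrable (hW : IsFilteredBrownian W 𝓕 P) (t : ℝ≥0) : Integrable (W t) P :=
  .of_eval_piLp fun i ↦ (hW.brownian_coord i).integrable_eval t

theorem integral_eq_zero (hW : IsFilteredBrownian W 𝓕 P) (t : ℝ≥0) : ∫ ω, W t ω ∂P = 0 := by
  ext i
  rw [eval_integral_piLp fun i ↦ (hW.brownian_coord i).integrable_eval t]
  exact (hW.brownian_coord i).integral_eval t

theorem integrable_noise (hW : IsFilteredBrownian W 𝓕 P) (t : ℝ≥0) :
    Integrable (fun ω ↦ √2 • (W t ω - W 0 ω)) P :=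
  ((hW.integrable t).sub (hW.integrable 0)).smul (√2 : ℝ)

theorem integral_noise (hW : IsFilteredBrownian W 𝓕 P) (t : ℝ≥0) :
    ∫ ω, √2 • (W t ω - W 0 ω) ∂P = 0 := by
  rw [integral_smul, integral_sub (hW.integrable _) (hW.integrable _), hW.integral_eq_zero,
    hW.integral_eq_zero, sub_zero, smul_zero]

theorem integrable_add_const_add_noise [IsFiniteMeasure P] (hW : IsFilteredBrownian W 𝓕 P)
    {ξ : Ω → EuclideanSpace ℝ (Fin d)} (hξ : Integrable ξ P) (c : EuclideanSpace ℝ (Fin d))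
    (t : ℝ≥0) : Integrable (fun ω ↦ ξ ω + c + √2 • (W t ω - W 0 ω)) P :=
  (hξ.add (integrable_const c)).add (hW.integrable_noise t)

theorem integral_add_const_add_noise [IsProbabilityMeasure P] (hW : IsFilteredBrownian W 𝓕 P)
    {ξ : Ω → EuclideanSpace ℝ (Fin d)} (hξ : Integrable ξ P) (c : EuclideanSpace ℝ (Fin d))
    (t : ℝ≥0) : ∫ ω, (ξ ω + c + √2 • (W t ω - W 0 ω)) ∂P = ∫ ω, ξ ω ∂P + c := by
  have hξc : Integrable (fun ω ↦ ξ ω + c) P := hξ.add (integrable_const c)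
  rw [integral_add hξc (hW.integrable_noise t), integral_add hξ (integrable_const c),
    hW.integral_noise, add_zero, integral_const, probReal_univ, one_smul]

theorem continuous_paths (hW : IsFilteredBrownian W 𝓕 P) :
    ∀ᵐ ω ∂P, Continuous fun t ↦ W t ω := by
  filter_upwards [ae_all_iff.2 fun i ↦ (hW.brownian_coord i).cont] with ω h
  exact (PiLp.continuous_toLp 2 _).comp (continuous_pi h)

end IsFilteredBrownian

theorem meanDrift_map {X : Ω → EuclideanSpace ℝ (Fin d)} (hX : Integrable X P) :
    meanDrift (P.map X) = ∫ ω, X ω ∂P :=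
  integral_map hX.aemeasurable aestronglyMeasurable_id

/-! ### The explicit solution -/

namespace IsSolution

variable {ξ : Ω → EuclideanSpace ℝ (Fin d)} {X : ℝ≥0 → Ω → EuclideanSpace ℝ (Fin d)}

theorem meanDrift_eq [IsProbabilityMeasure P] (hW : IsFilteredBrownian W 𝓕 P)
    (hX : IsSolution P 𝓕 W ξ X) {t : ℝ} (ht : 0 ≤ t) :
    meanDrift (P.map (X t.toNNReal)) = Real.exp t • ∫ ω, ξ ω ∂P := by
  refine eq_exp_smul_of_eq_add_integral (m := fun s : ℝ ↦ meanDrift (P.map (X s.toNNReal)))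
    (fun s hs ↦ by simpa [hs] using hX.integrable_drift s.toNNReal) (fun s hs ↦ ?_) ht
  -- Expectation of the integrated equation; the drift is already deterministic.
  rw [meanDrift_map (hX.integrable _), integral_congr_ae
    (hX.equation.mono fun ω h ↦ h s.toNNReal),
    hW.integral_add_const_add_noise (hX.integrable 0), integral_congr_ae hX.initial,
    Real.coe_toNNReal s hs]

theorem ae_eq_explicit [IsProbabilityMeasure P] (hW : IsFilteredBrownian W 𝓕 P)
    (hX : IsSolution P 𝓕 W ξ X) :
    ∀ᵐ ω ∂P, ∀ t : ℝ≥0,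
      X t ω = ξ ω + (Real.exp t - 1) • (∫ ω, ξ ω ∂P) + √2 • (W t ω - W 0 ω) := by
  filter_upwards [hX.equation, hX.initial] with ω h h0 t
  rw [h t, h0, ← integral_exp_smul, intervalIntegral.integral_congr fun s hs ↦ ?_]
  rw [Set.uIcc_of_le t.coe_nonneg] at hs
  exact hX.meanDrift_eq hW hs.1

end IsSolution

theorem isSolution_explicit [IsProbabilityMeasure P] (hW : IsFilteredBrownian W 𝓕 P)
    {ξ : Ω → EuclideanSpace ℝ (Fin d)} (hξm : StronglyMeasurable[𝓕 0] ξ) (hξ : Integrable ξ P) :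
    IsSolution P 𝓕 W ξ
      fun t ω ↦ ξ ω + (Real.exp t - 1) • (∫ ω, ξ ω ∂P) + √2 • (W t ω - W 0 ω) := by
  have hint := fun t : ℝ≥0 ↦ hW.integrable_add_const_add_noise hξ
    ((Real.exp t - 1) • ∫ ω, ξ ω ∂P) t
  have hmean {s : ℝ} (hs : 0 ≤ s) : meanDrift (P.map fun ω ↦ ξ ω +
      (Real.exp s.toNNReal - 1) • (∫ ω, ξ ω ∂P) + √2 • (W s.toNNReal ω - W 0 ω)) =
      Real.exp s • ∫ ω, ξ ω ∂P := by
    rw [meanDrift_map (hint _), hW.integral_add_const_add_noise hξ, Real.coe_toNNReal s hs]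
    module
  refine ⟨fun t ↦ ?_, ?_, hint, fun t ↦ ?_, ?_, ?_⟩
  · exact ((hξm.mono (𝓕.mono zero_le)).add stronglyMeasurable_const).add
      (((hW.adapted t).sub ((hW.adapted 0).mono (𝓕.mono zero_le))).const_smul (√2 : ℝ))
  · filter_upwards [hW.continuous_paths] with ω h
    fun_prop
  · refine (Continuous.intervalIntegrable (u := fun s : ℝ ↦ Real.exp s • ∫ ω, ξ ω ∂P)
      (by fun_prop) 0 t).congr fun s hs ↦ ?_
    rw [Set.uIoc_of_le t.coe_nonneg] at hs
    exact (hmean hs.1.le).symm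
  · exact .of_forall fun ω ↦ by simp
  · refine .of_forall fun ω t ↦ ?_
    rw [intervalIntegral.integral_congr (g := fun s ↦ Real.exp s • ∫ ω, ξ ω ∂P) fun s hs ↦ ?_,
      integral_exp_smul]
    · simp
    · rw [Set.uIcc_of_le t.coe_nonneg] at hs
      exact hmean hs.1

/-! ### Failure of convergence in probability -/

theorem norm_le_sum_abs (x : EuclideanSpace ℝ (Fin d)) : ‖x‖ ≤ ∑ i, |x i| := by
  rw [EuclideanSpace.norm_eq, Real.sqrt_le_left (Finset.sum_nonneg fun i _ ↦ abs_nonneg _)]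
  exact Finset.sum_sq_le_sq_sum_of_nonneg fun i _ ↦ abs_nonneg _

/-- For coordinatewise ordered random vectors, convergence of the means implies convergence
in `L^1`. -/
theorem tendsto_eLpNorm_one_of_le {ξ₀ : Ω → EuclideanSpace ℝ (Fin d)}
    {ξ : ℕ → Ω → EuclideanSpace ℝ (Fin d)} (h₀ : Integrable ξ₀ P) (hξ : ∀ k, Integrable (ξ k) P)
    (hle : ∀ k, ∀ᵐ ω ∂P, ∀ i, ξ₀ ω i ≤ ξ k ω i)
    (hmean : Tendsto (fun k ↦ ∫ ω, ξ k ω ∂P) atTop (𝓝 (∫ ω, ξ₀ ω ∂P))) :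
    Tendsto (fun k ↦ eLpNorm (ξ k - ξ₀) 1 P) atTop (𝓝 0) := by
  have hcoord {f : Ω → EuclideanSpace ℝ (Fin d)} (hf : Integrable f P) (i : Fin d) :
      Integrable (fun ω ↦ f ω i) P := hf.eval_piLp i
  -- The order removes the absolute values, so the L¹ distance is controlled by the coordinates of
  -- the means alone.
  have hbound (k : ℕ) : eLpNorm (ξ k - ξ₀) 1 P ≤
      ENNReal.ofReal (∑ i, ((∫ ω, ξ k ω ∂P) i - (∫ ω, ξ₀ ω ∂P) i)) := by
    rw [eLpNorm_one_eq_lintegral_enorm, ← ofReal_integral_norm_eq_lintegral_enorm ((hξ k).sub h₀)]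
    refine ENNReal.ofReal_le_ofReal ?_
    have hsub (i : Fin d) : Integrable (fun ω ↦ ξ k ω i - ξ₀ ω i) P :=
      (hcoord (hξ k) i).sub (hcoord h₀ i)
    simp_rw [eval_integral_piLp (hcoord (hξ k)), eval_integral_piLp (hcoord h₀),
      ← integral_sub (hcoord (hξ k) _) (hcoord h₀ _)]
    rw [← integral_finsetSum _ fun i _ ↦ hsub i]
    refine integral_mono_ae ((hξ k).sub h₀).norm (integrable_finsetSum _ fun i _ ↦ hsub i) ?_
    filter_upwards [hle k] with ω h
    refine (norm_le_sum_abs _).trans_eq (Finset.sum_congr rfl fun i _ ↦ ?_)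
    exact abs_of_nonneg (sub_nonneg.2 (h i))
  refine tendsto_of_tendsto_of_tendsto_of_le_of_le tendsto_const_nhds ?_ (fun _ ↦ zero_le) hbound
  rw [← ENNReal.ofReal_zero]
  refine ENNReal.tendsto_ofReal ?_
  have : Tendsto (fun k ↦ ∑ i, ((∫ ω, ξ k ω ∂P) i - (∫ ω, ξ₀ ω ∂P) i)) atTop
      (𝓝 (∑ i, ((∫ ω, ξ₀ ω ∂P) i - (∫ ω, ξ₀ ω ∂P) i))) :=
    tendsto_finsetSum _ fun i _ ↦
      (((EuclideanSpace.proj (𝕜 := ℝ) i).continuous.tendsto _).comp hmean).sub_const _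
  simpa using this

/-- If `f k → g` and `h k → g'` in measure and `h k - g' = f k - g + c k` for constants `c k`, then
`c k → 0`. -/
theorem tendsto_zero_of_tendstoInMeasure_add_const [IsProbabilityMeasure P]
    {E : Type*} [NormedAddCommGroup E] {f h : ℕ → Ω → E} {g g' : Ω → E}
    {c : ℕ → E} (hf : TendstoInMeasure P f atTop g) (hh : TendstoInMeasure P h atTop g')
    (hfh : ∀ k, ∀ᵐ ω ∂P, h k ω - g' ω = f k ω - g ω + c k) :
    Tendsto c atTop (𝓝 0) := by
  rw [tendstoInMeasure_iff_norm] at hf hh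
  refine Metric.tendsto_atTop'.2 fun ε hε ↦ ?_
  have hsum := (hf (ε / 2) (by positivity)).add (hh (ε / 2) (by positivity))
  rw [add_zero] at hsum
  obtain ⟨N, hN⟩ := eventually_atTop.1 (hsum.eventually (gt_mem_nhds zero_lt_one))
  refine ⟨N, fun k hk ↦ ?_⟩
  by_contra! hc
  rw [dist_zero_right] at hc
  refine (hN k hk.le).not_ge ?_
  -- If ‖c k‖ ≥ ε, almost every ω lies in one of the two deviation events at level ε / 2, since c k
  -- is the difference of the two deviations; but their probabilities sum to less than 1.
  calc (1 : ℝ≥0∞) = P Set.univ := measure_univ.symm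
    _ ≤ P ({ω | ε / 2 ≤ ‖f k ω - g ω‖} ∪ {ω | ε / 2 ≤ ‖h k ω - g' ω‖}) := by
      refine measure_mono_ae ?_
      filter_upwards [hfh k] with ω hω _
      by_contra hn
      change ¬ (ε / 2 ≤ ‖f k ω - g ω‖ ∨ ε / 2 ≤ ‖h k ω - g' ω‖) at hn
      push Not at hn
      have : c k = (h k ω - g' ω) - (f k ω - g ω) := by rw [hω]; abel
      have := this ▸ norm_sub_le (h k ω - g' ω) (f k ω - g ω)
      linarith [hn.1, hn.2]
    _ ≤ _ := measure_union_le _ _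

theorem not_tendstoInMeasure_of_isInitialData [IsProbabilityMeasure P]
    (hW : IsFilteredBrownian W 𝓕 P) {ξ₀ : Ω → EuclideanSpace ℝ (Fin d)}
    {ξ : ℕ → Ω → EuclideanSpace ℝ (Fin d)} (hξ : IsInitialData P 𝓕 ξ₀ ξ)
    {X : ℝ≥0 → Ω → EuclideanSpace ℝ (Fin d)} {Y : ℕ → ℝ≥0 → Ω → EuclideanSpace ℝ (Fin d)}
    (hX : IsSolution P 𝓕 W ξ₀ X) (hY : ∀ k, IsSolution P 𝓕 W (ξ k) (Y k)) {t : ℝ≥0} (ht : 0 < t) :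
    ¬ TendstoInMeasure P (fun k ↦ Y k t) atTop (X t) := by
  intro hconv
  have hc := tendsto_zero_of_tendstoInMeasure_add_const
    (c := fun k ↦ (Real.exp t - 1) • (∫ ω, ξ k ω ∂P - ∫ ω, ξ₀ ω ∂P)) hξ.tendsto_prob hconv
    fun k ↦ by
      filter_upwards [hX.ae_eq_explicit hW, (hY k).ae_eq_explicit hW] with ω h h'
      rw [h t, h' t]
      module
  -- Here t > 0 matters: at time 0 the difference of the means is not seen.
  have he : Real.exp t - 1 ≠ 0 := by
    have := Real.one_lt_exp_iff.2 (NNReal.coe_pos.2 ht)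
    linarith
  have hc' := hc.const_smul (Real.exp t - 1)⁻¹
  simp only [smul_smul, inv_mul_cancel₀ he, one_smul, smul_zero] at hc'
  exact hξ.not_tendsto_Lp 1 one_pos (by
    simpa using tendsto_eLpNorm_one_of_le hξ.integrable_zero hξ.integrable hξ.le
      (tendsto_sub_nhds_zero_iff.1 hc'))

theorem TendstoInProbUniformly.tendstoInMeasure {T : ℝ≥0}
    {X : ℝ≥0 → Ω → EuclideanSpace ℝ (Fin d)} {Y : ℕ → ℝ≥0 → Ω → EuclideanSpace ℝ (Fin d)}
    (h : TendstoInProbUniformly P T Y X) {t : ℝ≥0} (ht : t ≤ T) :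
    TendstoInMeasure P (fun k ↦ Y k t) atTop (X t) := by
  refine fun ε hε ↦ tendsto_of_tendsto_of_tendsto_of_le_of_le tendsto_const_nhds (h ε hε)
    (fun _ ↦ zero_le) fun k ↦ measure_mono fun ω (hω : ε ≤ _) ↦ ?_
  exact hω.trans (le_iSup₂ (f := fun t (_ : t ∈ Set.Icc 0 T) ↦ edist (Y k t ω) (X t ω))
    t ⟨zero_le, ht⟩)

/-! ### Existence of initial values -/

/-- The height `P(A)⁻ᵏ` on the event `A`, on top of the constant `1 / (k + 1)`. -/
noncomputable def spike (P : Measure Ω) (A : ℕ → Set Ω) (k : ℕ) (ω : Ω) : ℝ :=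
  1 / ((k : ℝ) + 1) + (A k).indicator (fun _ ↦ (P.real (A k))⁻¹ ^ k) ω

section spike

variable {A : ℕ → Set Ω}

/-- The summand 1 / (k + 1) gives strict positivity off `A k` too, so that the initial values differ
everywhere. -/
theorem spike_pos (k : ℕ) (ω : Ω) : 0 < spike P A k ω :=
  add_pos_of_pos_of_nonneg (by positivity) (Set.indicator_nonneg (fun _ _ ↦ by positivity) _)

theorem spike_le (k : ℕ) (ω : Ω) :
    spike P A k ω ≤ 1 / ((k : ℝ) + 1) + (P.real (A k))⁻¹ ^ k :=
  add_le_add_right (Set.indicator_le_self' (fun _ _ ↦ by positivity) _) _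

theorem measurable_spike {m : MeasurableSpace Ω} {k : ℕ} (hA : MeasurableSet[m] (A k)) :
    Measurable[m] (spike P A k) :=
  measurable_const.add (measurable_const.indicator hA)

/-- The spike alone has L^p norm P(A)^(1/p - k), which is at least 1 once k ≥ 1/p. Letting the
exponent grow with k defeats all p with one sequence. -/
theorem one_le_eLpNorm_spike [IsProbabilityMeasure P] {k : ℕ} (hA : MeasurableSet (A k))
    (hpos : 0 < P (A k)) {p : ℝ≥0} (hp : 0 < p) (hk : (p : ℝ)⁻¹ ≤ k) :
    1 ≤ eLpNorm (spike P A k) p P := by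
  have ha : 0 < P.real (A k) := ENNReal.toReal_pos hpos.ne' (measure_ne_top _ _)
  calc (1 : ℝ≥0∞) ≤ eLpNorm ((A k).indicator fun _ ↦ (P.real (A k))⁻¹ ^ k) p P := by
        rw [eLpNorm_indicator_const hA (by simpa using hp.ne') (by simp),
          ← ofReal_measureReal, Real.enorm_of_nonneg (by positivity),
          ENNReal.ofReal_rpow_of_pos ha, ← ENNReal.ofReal_mul (by positivity),
          ENNReal.one_le_ofReal, ← Real.rpow_natCast, Real.inv_rpow ha.le, ← Real.rpow_neg ha.le,
          ← Real.rpow_add ha]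
        exact Real.one_le_rpow_of_pos_of_le_one_of_nonpos ha measureReal_le_one (by simpa using hk)
    _ ≤ _ := eLpNorm_mono_real fun ω ↦ by
        rw [Real.norm_of_nonneg (Set.indicator_nonneg (fun _ _ ↦ by positivity) _)]
        exact le_add_of_nonneg_left (by positivity)

/-- Once 1 / (k + 1) < ε, a deviation of size ε can occur only on `A k`. -/
theorem tendstoInMeasure_spike (hA : Tendsto (fun k ↦ P (A k)) atTop (𝓝 0)) :
    TendstoInMeasure P (spike P A) atTop 0 := by
  rw [tendstoInMeasure_iff_norm]
  intro ε hε
  refine tendsto_of_tendsto_of_tendsto_of_le_of_le' tendsto_const_nhds hA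
    (.of_forall fun _ ↦ zero_le) ?_
  filter_upwards [(tendsto_one_div_add_atTop_nhds_zero_nat (𝕜 := ℝ)).eventually
    (gt_mem_nhds hε)] with k hk
  refine measure_mono fun ω (hω : ε ≤ ‖spike P A k ω - 0‖) ↦ ?_
  by_contra hn
  rw [sub_zero, Real.norm_of_nonneg (spike_pos k ω).le, spike, Set.indicator_of_notMem hn] at hω
  linarith

end spike

theorem exists_isInitialData [IsProbabilityMeasure P] (hd : 0 < d)
    (h𝓕 : ∀ ε : ℝ≥0∞, 0 < ε → ∃ A, MeasurableSet[𝓕 0] A ∧ 0 < P A ∧ P A < ε) :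
    ∃ (ξ₀ : Ω → EuclideanSpace ℝ (Fin d)) (ξ : ℕ → Ω → EuclideanSpace ℝ (Fin d)),
      IsInitialData P 𝓕 ξ₀ ξ ∧ (∀ k, ∀ᵐ ω ∂P, ξ k ω ≠ ξ₀ ω) ∧
      MemLp ξ₀ 2 P ∧ ∀ k, MemLp (ξ k) 2 P := by
  choose A hAm hApos hAlt using fun k : ℕ ↦ h𝓕 ((k : ℝ≥0∞) + 1)⁻¹ (by simp)
  have hA0 : Tendsto (fun k ↦ P (A k)) atTop (𝓝 0) := by
    refine tendsto_of_tendsto_of_tendsto_of_le_of_le tendsto_const_nhds ?_ (fun _ ↦ zero_le)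
      fun k ↦ (hAlt k).le
    simpa using (tendsto_add_atTop_iff_nat 1).2 ENNReal.tendsto_inv_nat_nhds_zero
  set e : EuclideanSpace ℝ (Fin d) := EuclideanSpace.single ⟨0, hd⟩ 1 with he_def
  have he : ‖e‖ = 1 := by simp [he_def]
  have he0 : e ≠ 0 := norm_ne_zero_iff.1 (by simp [he])
  have hne (k : ℕ) (ω : Ω) : spike P A k ω • e ≠ 0 := smul_ne_zero (spike_pos k ω).ne' he0
  have hmeas (k : ℕ) : StronglyMeasurable[𝓕 0] fun ω ↦ spike P A k ω • e :=
    (measurable_spike (hAm k)).stronglyMeasurable.smul_const e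
  -- For fixed k the spike is bounded, which gives integrability and square integrability at once.
  have hmem (k : ℕ) (p : ℝ≥0∞) : MemLp (fun ω ↦ spike P A k ω • e) p P :=
    .of_bound ((hmeas k).mono (𝓕.le 0)).aestronglyMeasurable _ (.of_forall fun ω ↦ by
      rw [norm_smul, he, mul_one, Real.norm_of_nonneg (spike_pos k ω).le]
      exact spike_le k ω)
  refine ⟨0, fun k ω ↦ spike P A k ω • e, ?_, fun k ↦ .of_forall (hne k), .zero,
    fun k ↦ hmem k 2⟩
  refine ⟨stronglyMeasurable_zero, hmeas, integrable_zero _ _ _, fun k ↦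
    memLp_one_iff_integrable.1 (hmem k 1), fun k ↦ .of_forall fun ω i ↦ ?_, fun k hk ↦ ?_, ?_, ?_⟩
  · have : 0 ≤ e i := by
      rw [he_def, PiLp.single_apply]
      split_ifs <;> simp
    simpa using mul_nonneg (spike_pos k ω).le this
  · obtain ⟨ω, hω⟩ := hk.exists
    exact hne k ω hω
  · simpa only [tendstoInMeasure_iff_norm, Pi.zero_apply, sub_zero, norm_smul, he, mul_one]
      using tendstoInMeasure_spike hA0
  · intro p hp hlim
    obtain ⟨k, hk, hkp⟩ := ((hlim.eventually (gt_mem_nhds zero_lt_one)).and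
      (tendsto_natCast_atTop_atTop.eventually_ge_atTop (p : ℝ)⁻¹)).exists
    refine hk.not_ge ((one_le_eLpNorm_spike (𝓕.le 0 _ (hAm k)) (hApos k) hp hkp).trans_eq ?_)
    exact eLpNorm_congr_norm_ae (.of_forall fun ω ↦ by simp [norm_smul, he])

end MVSDE

theorem mainTheorem6 {Ω : Type*} {mΩ : MeasurableSpace Ω} (P : Measure Ω) [IsProbabilityMeasure P]
    (𝓕 : Filtration ℝ≥0 mΩ) (d : ℕ) (hd : 0 < d) (W : ℝ≥0 → Ω → EuclideanSpace ℝ (Fin d))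
    (hW : MVSDE.IsFilteredBrownian W 𝓕 P) :
    -- the equation is well posed for integrable initial values
    (∀ ξ : Ω → EuclideanSpace ℝ (Fin d), StronglyMeasurable[𝓕 0] ξ → Integrable ξ P →
      (∃ X, MVSDE.IsSolution P 𝓕 W ξ X) ∧
      ∀ X Y, MVSDE.IsSolution P 𝓕 W ξ X → MVSDE.IsSolution P 𝓕 W ξ Y →
        ∀ᵐ ω ∂P, ∀ t, X t ω = Y t ω) ∧
    -- the solutions do not converge in probability
    (∀ (ξ₀ : Ω → EuclideanSpace ℝ (Fin d)) (ξ : ℕ → Ω → EuclideanSpace ℝ (Fin d)),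
      MVSDE.IsInitialData P 𝓕 ξ₀ ξ →
      ∀ (X : ℝ≥0 → Ω → EuclideanSpace ℝ (Fin d)) (Y : ℕ → ℝ≥0 → Ω → EuclideanSpace ℝ (Fin d)),
        MVSDE.IsSolution P 𝓕 W ξ₀ X → (∀ k, MVSDE.IsSolution P 𝓕 W (ξ k) (Y k)) →
        (∀ t : ℝ≥0, 0 < t → ¬ TendstoInMeasure P (fun k ↦ Y k t) atTop (X t)) ∧
        (∀ T : ℝ≥0, 0 < T → ¬ MVSDE.TendstoInProbUniformly P T Y X)) ∧
    -- such initial values exist, as soon as `𝓕 0` has events of arbitrarily small probability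
    ((∀ ε : ℝ≥0∞, 0 < ε → ∃ A, MeasurableSet[𝓕 0] A ∧ 0 < P A ∧ P A < ε) →
      ∃ (ξ₀ : Ω → EuclideanSpace ℝ (Fin d)) (ξ : ℕ → Ω → EuclideanSpace ℝ (Fin d)),
        MVSDE.IsInitialData P 𝓕 ξ₀ ξ ∧ (∀ k, ∀ᵐ ω ∂P, ξ k ω ≠ ξ₀ ω) ∧
        MemLp ξ₀ 2 P ∧ ∀ k, MemLp (ξ k) 2 P) := by
  refine ⟨fun ξ hξm hξ ↦ ⟨⟨_, MVSDE.isSolution_explicit hW hξm hξ⟩, fun X Y hX hY ↦ ?_⟩,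
    fun ξ₀ ξ hξ X Y hX hY ↦ ⟨fun t ht ↦
      MVSDE.not_tendstoInMeasure_of_isInitialData hW hξ hX hY ht, fun T hT h ↦
      MVSDE.not_tendstoInMeasure_of_isInitialData hW hξ hX hY hT (h.tendstoInMeasure le_rfl)⟩,
    fun h ↦ MVSDE.exists_isInitialData hd h⟩
  filter_upwards [hX.ae_eq_explicit hW, hY.ae_eq_explicit hW] with ω h h' t
  rw [h t, h' t]
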